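/- Let $F$ be a closed surface (a compact connected surface without boundary) that is orientable, and let $G$ be a finite graph (loops and multiple edges allowed) cellularly embedded in $F$, i.e. every component of $F\setminus G$ is an open disk. Let $G_m$ be the medial graph of $G$: it has one vertex on each edge of $G$, and one edge for each corner of a face of $G$, joining the medial vertices on the two edges of $G$ that meet at that corner. A Penrose state $s$ of $G_m$ chooses at every vertex of $G_m$ either the white smoothing (which joins the two medial edge ends lying on the same side of the corresponding edge of $G$) or the crossing (which joins opposite medial edge ends). Let $cr(s)$ be the number of crossings of $s$ and $c(s)$ the number of closed curves obtained (equivalently, the number of boundary components of the ribbon graph obtained from that of $G$ by giving a half-twist to the ribbons of the edges where $s$ has a crossing). The Penrose polynomial of $G$ is $P(G;\lambda)=\sum_s(-1)^{cr(s)}\lambda^{c(s)}$, the sum being over all Penrose states $s$ of $G_m$. Then: (i) If $G$ has at least one edge, then $P(G;1)=0$. (ii) If $G$ has $p$ vertices and each vertex has degree $4$, then $P(G;2)=2^{p}$. (iii) In particular, suppose that $G$ is the Heegaard graph of a Heegaard diagram $(F;v,w)$. That is, $v$ and $w$ are two systems of $g$ pairwise disjoint simple closed curves each, where $g$ is the genus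 of $F$, such that $F\setminus v$ and $F\setminus w$ are connected and $v$ and $w$ meet transversally; the image of $G$ is $v\cup w$, its vertices are the points of $v\cap w$, and its edges are the components of $(v\cup w)\setminus(v\cap w)$. Then the number of vertices of $G$ is $\log_2 P(G;2)$. -/

import Mathlib

open Set

/-- `f` restricted to `[0,1] × [-1,1]` is an embedded Möbius band: it is continuous, and its only
identifications are `(0, y) ∼ (1, -y)`. -/
def IsMobiusBand {F : Type*} [TopologicalSpace F] (f : ℝ × ℝ → F) : Prop :=
  ContinuousOn f (Icc 0 1 ×ˢ Icc (-1) 1) ∧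
  ∀ s ∈ Icc (0 : ℝ) 1, ∀ y ∈ Icc (-1 : ℝ) 1, ∀ t ∈ Icc (0 : ℝ) 1, ∀ z ∈ Icc (-1 : ℝ) 1,
    f (s, y) = f (t, z) ↔
      (s = t ∧ y = z) ∨ (s = 0 ∧ t = 1 ∧ z = -y) ∨ (s = 1 ∧ t = 0 ∧ z = -y)

/-- A surface is orientable if it contains no Möbius band. -/
def IsOrientableSurface (F : Type*) [TopologicalSpace F] : Prop :=
  ¬ ∃ f : ℝ × ℝ → F, IsMobiusBand f

/-- A finite graph (loops and multiple edges allowed) together with an embedding in `F`, that is,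
an injective continuous map to `F` from its geometric realization. Each edge `e` has two ends
`(e, false)`, `(e, true)`; the embedding is given by the images of the vertices and by a path
`arc e` along each edge. -/
structure EmbeddedGraph (F : Type*) [TopologicalSpace F] where
  V : Type
  E : Type
  [fintypeV : Fintype V]
  [fintypeE : Fintype E]
  ends : E → Bool → V
  point : V → F
  arc : E → C(unitInterval, F)
  arc_zero : ∀ e, arc e 0 = point (ends e false)
  arc_one : ∀ e, arc e 1 = point (ends e true)
  point_injective : Function.Injective point
  arc_injective : ∀ e e' : E, ∀ s ∈ Ioo (0 : unitInterval) 1, ∀ t ∈ Ioo (0 : unitInterval) 1,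
    arc e s = arc e' t → e = e' ∧ s = t
  arc_ne_point : ∀ e, ∀ s ∈ Ioo (0 : unitInterval) 1, ∀ v, arc e s ≠ point v

attribute [instance] EmbeddedGraph.fintypeV EmbeddedGraph.fintypeE

/-- A combinatorial cell decomposition of a closed surface, given by its flags (the triangles
of the barycentric subdivision, with one corner at a vertex, one at an edge midpoint and one at a
face centre). `τ 0`, `τ 1`, `τ 2` take a flag to the neighbouring flag that differs from it in the
vertex, in the edge, in the face, respectively. -/
structure FlagSystem where
  Flag : Type
  [fintypeFlag : Fintype Flag]
  τ : Fin 3 → Flag → Flag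
  τ_τ : ∀ i x, τ i (τ i x) = x
  τ_ne : ∀ i x, τ i x ≠ x
  τ_comm : ∀ x, τ 0 (τ 2 x) = τ 2 (τ 0 x)
  τ_τ_ne : ∀ x, τ 0 (τ 2 x) ≠ x

attribute [instance] FlagSystem.fintypeFlag

namespace FlagSystem

/-- The triangle of `x` and that of `τ i x` are glued along the side opposite to the corner `i`. -/
inductive Glue (M : FlagSystem) :
    (Σ _ : M.Flag, stdSimplex ℝ (Fin 3)) → (Σ _ : M.Flag, stdSimplex ℝ (Fin 3)) → Prop
  | side (i : Fin 3) (x : M.Flag) (p : stdSimplex ℝ (Fin 3)) (hp : p.1 i = 0) :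
      Glue M ⟨x, p⟩ ⟨M.τ i x, p⟩

/-- The closed surface obtained by gluing one triangle for each flag. -/
abbrev Surface (M : FlagSystem) : Type := Quot M.Glue

end FlagSystem

/-- The point at parameter `t` on the side from the vertex corner (corner `0`) to the edge corner
(corner `1`) of a flag triangle. -/
def sidePoint (t : unitInterval) : stdSimplex ℝ (Fin 3) :=
  ⟨![1 - t, t, 0], by
    constructor
    · intro i
      fin_cases i
      · simpa using t.2.2
      · simpa using t.2.1
      · simp
    · simp [Fin.sum_univ_three]⟩

/-- The parameter `t / 2` on an edge, measured from its first end (`false`) or from its second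
end (`true`). -/
noncomputable def halfParam (b : Bool) (t : unitInterval) : unitInterval :=
  let u : unitInterval := ⟨t / 2, by linarith [t.2.1], by linarith [t.2.2]⟩
  if b then unitInterval.symm u else u

namespace EmbeddedGraph

variable {F : Type*} [TopologicalSpace F]

/-- The image of the graph in the surface. -/
def carrier (G : EmbeddedGraph F) : Set F :=
  range G.point ∪ ⋃ e, range (G.arc e)

/-- Every component of the complement of the graph is an open disk. -/
def IsCellular (G : EmbeddedGraph F) : Prop :=
  ∀ x ∈ G.carrierᶜ,
    Nonempty (connectedComponentIn G.carrierᶜ x ≃ₜ Metric.ball (0 : EuclideanSpace ℝ (Fin 2)) 1)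

/-- The number of edge ends at `v`, so that a loop counts twice. -/
noncomputable def degree (G : EmbeddedGraph F) (v : G.V) : ℕ :=
  Nat.card {h : G.E × Bool // G.ends h.1 h.2 = v}

/-- A ribbon structure of a cellularly embedded graph: a barycentric subdivision of the surface
along the graph. The surface is the union of the flag triangles, and the side of a flag `x` from
its vertex to its edge midpoint is the half `half x` of an edge of `G`. The two flags with a given
half-edge are the two sides of that half-edge. The triangles around a vertex form its vertex disk,
and the ribbon graph of `G` is a neighbourhood of the graph in this subdivision. Every graph with
at least one edge that is cellularly embedded in a closed surface has such a subdivision, and its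
flags with `τ` and `half` are determined by the embedding up to isomorphism. -/
structure RibbonStructure (G : EmbeddedGraph F) extends FlagSystem where
  half : Flag → G.E × Bool
  half_surjective : Function.Surjective half
  homeo : toFlagSystem.Surface ≃ₜ F
  homeo_side : ∀ (x : Flag) (t : unitInterval),
    homeo (Quot.mk _ ⟨x, sidePoint t⟩) = G.arc (half x).1 (halfParam (half x).2 t)

namespace RibbonStructure

variable {G : EmbeddedGraph F} (R : G.RibbonStructure)

/-- The medial graph has a vertex on each edge of `G`, and an edge for each corner `{x, τ 1 x}`
of `G`; its four edge ends at the medial vertex `e` are the four flags of `e`. A Penrose state is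
given by the set `A` of the medial vertices with a crossing; the others have a white smoothing.
The white smoothing joins `x` to `τ 0 x` (the other end on the same side of the edge), the crossing
joins `x` to the opposite end `τ 0 (τ 2 x)`. The relation describes how a curve of the state runs:
along a medial edge, or through a medial vertex. -/
def StateStep (A : Finset G.E) (x y : R.Flag) : Prop :=
  y = R.τ 1 x ∨
  ((R.half x).1 ∉ A ∧ y = R.τ 0 x) ∨
  ((R.half x).1 ∈ A ∧ y = R.τ 0 (R.τ 2 x))

/-- The number of closed curves of a Penrose state, that is, of boundary components of the ribbon
graph in which the ribbons of the edges in `A` have been given a half-twist. -/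
noncomputable def stateCurves (A : Finset G.E) : ℕ :=
  Nat.card (Quot (R.StateStep A))

/-- The Penrose polynomial. -/
noncomputable def penrose : Polynomial ℤ :=
  ∑ A : Finset G.E, (-1) ^ A.card * Polynomial.X ^ R.stateCurves A

end RibbonStructure

end EmbeddedGraph

/-- `n` pairwise disjoint simple closed curves whose complement is connected. -/
structure IsCutSystem {F : Type*} [TopologicalSpace F] {n : ℕ} (c : Fin n → C(Circle, F)) :
    Prop where
  simple : ∀ i, Function.Injective (c i)
  disjoint : ∀ i j, i ≠ j → Disjoint (range (c i)) (range (c j))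
  connected : IsConnected (⋃ i, range (c i))ᶜ

/-- The genus of a closed orientable surface: the largest number of disjoint simple closed curves
that together do not separate it. -/
def HasGenus (F : Type*) [TopologicalSpace F] (g : ℕ) : Prop :=
  IsGreatest {n : ℕ | ∃ c : Fin n → C(Circle, F), IsCutSystem c} g

/-- A Heegaard diagram `(F; v, w)` on the closed orientable surface `F` of genus `g`. -/
structure HeegaardDiagram (F : Type*) [TopologicalSpace F] where
  g : ℕ
  genus : HasGenus F g
  v : Fin g → C(Circle, F)
  w : Fin g → C(Circle, F)
  cut_v : IsCutSystem v
  cut_w : IsCutSystem w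
  /-- At each intersection point the two systems look like the two coordinate axes. -/
  transverse : ∀ p ∈ (⋃ i, range (v i)) ∩ ⋃ j, range (w j),
    ∃ φ : OpenPartialHomeomorph F (ℝ × ℝ), p ∈ φ.source ∧ ∀ q ∈ φ.source,
      (q ∈ (⋃ i, range (v i)) ↔ (φ q).2 = 0) ∧ (q ∈ (⋃ j, range (w j)) ↔ (φ q).1 = 0)

/-- `G` is the Heegaard graph of `D`: its image is the union of all curves, its vertices are the
intersection points of the two systems (so its open edges are the components of the rest). -/
def HeegaardDiagram.IsHeegaardGraph {F : Type*} [TopologicalSpace F] (D : HeegaardDiagram F)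
    (G : EmbeddedGraph F) : Prop :=
  range G.point = (⋃ i, range (D.v i)) ∩ (⋃ j, range (D.w j)) ∧
  G.carrier = (⋃ i, range (D.v i)) ∪ (⋃ j, range (D.w j))

/-! At `1` every state contributes only its sign, and the signs cancel over the subsets of a
nonempty edge set.

At `2`, the number `2 ^ c(s)` counts the two-colourings of the medial edge ends that are constant
along the curves of `s`. Exchanging the sums gives a sum over `τ 1`-invariant colourings of a
product over edges of local weights, [compatible with white] − [compatible with crossing]
(`penrose_eval_two`). If the two sides of some half-edge agree in colour, both conditions at that
edge coincide and the weight is `0` (`weight_eq_zero`). Only colourings that alternate around every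
vertex survive. With even positive degrees there are two of them per vertex, `2 ^ p` in all
(`exists_isAlternating`, `card_isAlternating`), and on an orientable surface each has total weight
`1` (`prod_weight`).

Orientability is turned into a sign on flags: an odd closed walk of flags would carry a strip of
triangles closing up to a Möbius band (`exists_orientation`). For a Heegaard graph, a transverse
crossing looks like two coordinate axes, whose four arms correspond to the half-edges at the vertex
(`degree_eq_four`). -/

/-! ### Odd closed walks. -/

/-- If a relation has an odd closed walk, then it has one that visits no point twice. -/
theorem exists_simple_odd_closed_walk {α : Type*} {r : α → α → Prop} {n : ℕ} {x : ℕ → α}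
    (hn : Odd n) (hr : ∀ k < n, r (x k) (x (k + 1))) (hx : x n = x 0) :
    ∃ (m : ℕ) (y : ℕ → α), Odd m ∧ (∀ k < m, r (y k) (y (k + 1))) ∧ y m = y 0 ∧
      InjOn y (Iio m) := by
  induction n using Nat.strong_induction_on generalizing x with
  | _ n ih =>
    by_cases hinj : InjOn x (Iio n)
    · exact ⟨n, x, hn, hr, hx, hinj⟩
    · obtain ⟨a, b, hab, hb, hxab⟩ : ∃ a b, a < b ∧ b < n ∧ x a = x b := by
        simp only [InjOn, not_forall, mem_Iio] at hinj
        obtain ⟨a, ha, b, hb, h, hne⟩ := hinj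
        rcases lt_or_gt_of_ne hne with h' | h'
        · exact ⟨a, b, h', hb, h⟩
        · exact ⟨b, a, h', ha, h.symm⟩
      -- The repeated point splits the walk into two shorter closed walks of total length `n`; one
      -- of them is odd.
      rcases Nat.even_or_odd (b - a) with hev | hodd
      · refine ih (n - (b - a)) (by omega) (x := fun k => if k ≤ a then x k else x (k + (b - a)))
          ?_ ?_ ?_
        · rcases hn with ⟨c, hc⟩
          rcases hev with ⟨d, hd⟩
          exact ⟨c - d, by omega⟩
        · intro k hk
          rcases lt_trichotomy k a with h | h | h
          · simpa [h.le, Nat.succ_le_of_lt h] using hr k (by omega)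
          · subst h
            have h1 : k + 1 + (b - k) = b + 1 := by omega
            simpa [h1, hxab] using hr b hb
          · have h1 : k + 1 + (b - a) = k + (b - a) + 1 := by omega
            simpa [h.not_ge, show ¬ (k + 1 ≤ a) by omega, h1] using hr (k + (b - a)) (by omega)
        · have h1 : n - (b - a) + (b - a) = n := by omega
          simp [show ¬ (n - (b - a) ≤ a) by omega, h1, hx]
      · refine ih (b - a) (by omega) (x := fun k => x (a + k)) hodd ?_ ?_
        · intro k hk
          exact hr (a + k) (by omega)
        · simp [show a + (b - a) = b by omega, hxab]

/-! ### Identifications between flag triangles. -/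

namespace FlagSystem

variable (M : FlagSystem)

/-- The flags that meet in the point `p` of the triangle. -/
def Meet (p : stdSimplex ℝ (Fin 3)) (x y : M.Flag) : Prop := ∃ i, p.1 i = 0 ∧ y = M.τ i x

variable {M}

/-- Gluing never changes barycentric coordinates, so a chain of gluings only moves between flags at
one fixed `p`. -/
theorem mk_eq_mk_iff {x y : M.Flag} {p q : stdSimplex ℝ (Fin 3)} :
    (Quot.mk M.Glue ⟨x, p⟩ = Quot.mk M.Glue ⟨y, q⟩) ↔
      p = q ∧ Relation.EqvGen (M.Meet p) x y := by
  constructor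
  · intro h
    have key : ∀ a b : (Σ _ : M.Flag, stdSimplex ℝ (Fin 3)), Relation.EqvGen M.Glue a b →
        a.2 = b.2 ∧ Relation.EqvGen (M.Meet a.2) a.1 b.1 := by
      intro a b hab
      induction hab with
      | rel a b h =>
        obtain ⟨i, x, p, hp⟩ := h
        exact ⟨rfl, .rel _ _ ⟨i, hp, rfl⟩⟩
      | refl a => exact ⟨rfl, .refl _⟩
      | symm a b _ ih => exact ⟨ih.1.symm, ih.1 ▸ ih.2.symm⟩
      | trans a b c _ _ ih1 ih2 => exact ⟨ih1.1.trans ih2.1, ih1.2.trans _ _ _ (ih1.1 ▸ ih2.2)⟩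
    exact key _ _ (Quot.eqvGen_exact h)
  · rintro ⟨rfl, h⟩
    induction h with
    | rel a b h =>
      obtain ⟨i, hp, rfl⟩ := h
      exact Quot.sound (.side i _ _ hp)
    | refl => rfl
    | symm _ _ _ ih => exact ih.symm
    | trans _ _ _ _ _ ih1 ih2 => exact ih1.trans ih2

/-- A set of flags that is closed under the gluings at `p` contains all flags meeting in `p`. -/
theorem mem_of_eqvGen_meet {p : stdSimplex ℝ (Fin 3)} {S : Set M.Flag}
    (hS : ∀ i, p.1 i = 0 → ∀ x ∈ S, M.τ i x ∈ S) {x y : M.Flag}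
    (h : Relation.EqvGen (M.Meet p) x y) : x ∈ S ↔ y ∈ S := by
  induction h with
  | rel a b h =>
    obtain ⟨i, hp, rfl⟩ := h
    refine ⟨hS i hp a, fun h => ?_⟩
    simpa [M.τ_τ] using hS i hp _ h
  | refl => rfl
  | symm _ _ _ ih => exact ih.symm
  | trans _ _ _ _ _ ih1 ih2 => exact ih1.trans ih2

/-- A point of a triangle that lies on no side except possibly `i` belongs to at most two
triangles. -/
theorem eq_or_eq_of_mk_eq_mk {x y : M.Flag} {p q : stdSimplex ℝ (Fin 3)}
    (h : Quot.mk M.Glue ⟨x, p⟩ = Quot.mk M.Glue ⟨y, q⟩) (i : Fin 3) (hp : ∀ k, p.1 k = 0 → k = i) :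
    y = x ∨ (p.1 i = 0 ∧ y = M.τ i x) := by
  have h' := (mk_eq_mk_iff.1 h).2
  by_cases hi : p.1 i = 0
  · have := (mem_of_eqvGen_meet (S := {x, M.τ i x}) ?_ h').1 (by simp)
    · simpa [hi] using this
    · intro k hk z hz
      rw [hp k hk]
      rcases hz with rfl | rfl
      · simp
      · simp [M.τ_τ]
  · have := (mem_of_eqvGen_meet (S := {x}) ?_ h').1 (by simp)
    · exact .inl this
    · intro k hk
      exact absurd (hp k hk ▸ hk) hi

/-! ### Strips of triangles and Möbius bands. -/

/-- The point with parameter `y` on the middle part of the side `i` of a triangle, directed from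
the corner `i + 1` to the corner `i + 2`. -/
noncomputable def gate (i : Fin 3) (y : ℝ) (k : Fin 3) : ℝ :=
  if k = i then 0 else if k = i + 1 then 1 / 2 - y / 4 else 1 / 2 + y / 4

/-- The quadrilateral that joins the middle parts of the sides `i` and `j`. -/
noncomputable def quad (i j : Fin 3) (u y : ℝ) (k : Fin 3) : ℝ :=
  -- The sign in `-y` keeps the quadrilateral untwisted: the coordinate at the common corner of the
  -- two sides does not depend on `u`.
  (1 - u) * gate i y k + u * gate j (-y) k

theorem quad_mem_stdSimplex (i j : Fin 3) {u y : ℝ} (hu : u ∈ Icc (0 : ℝ) 1)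
    (hy : y ∈ Icc (-1 : ℝ) 1) : quad i j u y ∈ stdSimplex ℝ (Fin 3) := by
  have hg : ∀ i : Fin 3, ∀ y ∈ Icc (-1 : ℝ) 1, gate i y ∈ stdSimplex ℝ (Fin 3) := by
    intro i y hy
    refine ⟨fun k => ?_, ?_⟩
    · unfold gate
      split_ifs <;> linarith [hy.1, hy.2]
    · fin_cases i <;> simp [gate, Fin.sum_univ_three] <;> ring
  have := (convex_stdSimplex ℝ (Fin 3)) (hg i y hy)
    (hg j (-y) ⟨by linarith [hy.2], by linarith [hy.1]⟩) (a := 1 - u) (b := u) (by linarith [hu.2])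
    hu.1 (by ring)
  exact this

/-- Barycentric coordinates of the quadrilateral, `l` being the common corner of the sides. -/
theorem exists_quad_eq {i j : Fin 3} (hij : i ≠ j) :
    ∃ (l : Fin 3) (s : ℝ), (s = 1 ∨ s = -1) ∧ (∀ k, k = i ∨ k = j ∨ k = l) ∧
      ∀ u y, quad i j u y l = 1 / 2 + s * y / 4 ∧ quad i j u y i = u * (1 / 2 - s * y / 4) ∧
        quad i j u y j = (1 - u) * (1 / 2 - s * y / 4) := by
  rcases (by decide : ∀ i j : Fin 3, i ≠ j → j = i + 1 ∨ j = i + 2) i j hij with rfl | rfl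
  · refine ⟨i + 2, 1, .inl rfl, by revert i; decide, fun u y => ?_⟩
    fin_cases i <;> simp [quad, gate] <;> ring_nf <;> simp
  · refine ⟨i + 1, -1, .inr rfl, by revert i; decide, fun u y => ?_⟩
    fin_cases i <;> simp [quad, gate] <;> ring_nf <;> simp

theorem quad_eq_zero {i j : Fin 3} (hij : i ≠ j) {u y : ℝ}
    (hy : y ∈ Icc (-1 : ℝ) 1) {k : Fin 3} (hk : quad i j u y k = 0) :
    (k = i ∧ u = 0) ∨ (k = j ∧ u = 1) := by
  obtain ⟨l, s, hs, hl, hq⟩ := exists_quad_eq hij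
  obtain ⟨h1, h2, h3⟩ := hq u y
  have hpos : 0 < 1 / 2 - s * y / 4 ∧ 0 < 1 / 2 + s * y / 4 := by
    rcases hs with rfl | rfl <;> constructor <;> linarith [hy.1, hy.2]
  rcases hl k with rfl | rfl | rfl
  · rw [h2] at hk
    exact .inl ⟨rfl, (mul_eq_zero.1 hk).resolve_right hpos.1.ne'⟩
  · rw [h3] at hk
    have := (mul_eq_zero.1 hk).resolve_right hpos.1.ne'
    exact .inr ⟨rfl, by linarith⟩
  · rw [h1] at hk
    exact absurd hk hpos.2.ne'

theorem quad_injective {i j : Fin 3} (hij : i ≠ j) {u u' y y' : ℝ} (hy : y ∈ Icc (-1 : ℝ) 1)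
    (h : quad i j u y = quad i j u' y') : u = u' ∧ y = y' := by
  obtain ⟨l, s, hs, -, hq⟩ := exists_quad_eq hij
  obtain ⟨h1, h2, -⟩ := hq u y
  obtain ⟨h1', h2', -⟩ := hq u' y'
  rw [h, h1'] at h1
  rw [h, h2'] at h2
  have hyy : y = y' := by
    rcases hs with rfl | rfl <;> linarith
  subst hyy
  have hpos : 1 / 2 - s * y / 4 ≠ 0 := by
    rcases hs with rfl | rfl <;> linarith [hy.1, hy.2]
  exact ⟨(mul_right_cancel₀ hpos h2).symm, rfl⟩

theorem continuous_quad (i j : Fin 3) (ε : ℝ) (a b : ℝ) :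
    Continuous fun p : ℝ × ℝ => quad i j (a * p.1 - b) (ε * p.2) := by
  refine continuous_pi fun k => ?_
  unfold quad gate
  split_ifs <;> fun_prop

open Classical in
/-- The triangle of `x` as a map from the plane of barycentric coordinates. -/
noncomputable def place (x : M.Flag) (p : Fin 3 → ℝ) : M.Surface :=
  if h : p ∈ stdSimplex ℝ (Fin 3) then Quot.mk _ ⟨x, ⟨p, h⟩⟩ else
    -- Irrelevant default value: strips stay inside the simplex by `quad_mem_stdSimplex`.
    Quot.mk _ ⟨x, sidePoint 0⟩

theorem continuousOn_place (x : M.Flag) : ContinuousOn (place x) (stdSimplex ℝ (Fin 3)) := by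
  rw [continuousOn_iff_continuous_domRestrict]
  have : (stdSimplex ℝ (Fin 3)).domRestrict (place x) = fun p => Quot.mk M.Glue ⟨x, p⟩ := by
    ext p
    exact dif_pos p.2
  rw [this]
  exact continuous_quot_mk.comp (continuous_sigmaMk (σ := fun _ : M.Flag => stdSimplex ℝ (Fin 3)))

/-- The strip that runs through the triangles `x 0`, `x 1`, ..., entering `x k` through the side
`j k` and leaving it through the side `j (k + 1)`. -/
noncomputable def strip (n : ℕ) (x : ℕ → M.Flag) (j : ℕ → Fin 3) (p : ℝ × ℝ) : M.Surface :=
  place (x ⌊n * p.1⌋₊) (quad (j ⌊n * p.1⌋₊) (j (⌊n * p.1⌋₊ + 1))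
    (n * p.1 - ⌊n * p.1⌋₊) ((-1) ^ ⌊n * p.1⌋₊ * p.2))

theorem neg_one_pow_mul_mem_Icc (k : ℕ) {y : ℝ} (hy : y ∈ Icc (-1 : ℝ) 1) :
    (-1) ^ k * y ∈ Icc (-1 : ℝ) 1 := by
  rcases neg_one_pow_eq_or ℝ k with h | h <;> rw [h] <;> constructor <;> linarith [hy.1, hy.2]

theorem quad_zero (i j : Fin 3) (y : ℝ) : quad i j 0 y = gate i y := by
  ext k; simp [quad]

theorem quad_one (i j : Fin 3) (y : ℝ) : quad i j 1 y = gate j (-y) := by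
  ext k; simp [quad]

theorem place_gate (x : M.Flag) (i : Fin 3) {y : ℝ} (hy : y ∈ Icc (-1 : ℝ) 1) :
    place (M.τ i x) (gate i y) = place x (gate i y) := by
  have h : gate i y ∈ stdSimplex ℝ (Fin 3) := by
    simpa [quad_zero] using quad_mem_stdSimplex i i (u := 0) (by simp) hy
  rw [place, place, dif_pos h, dif_pos h]
  exact (Quot.sound (.side i x ⟨_, h⟩ (by simp [gate]))).symm

section strip

variable {n : ℕ} {x : ℕ → M.Flag} {j : ℕ → Fin 3}

/-- The closed interval matters: at its right end the floor has already jumped to `k + 1`, but both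
formulas describe the same gate on the side shared by the two triangles. -/
theorem strip_eq_of_mem (hx : ∀ k < n, x (k + 1) = M.τ (j (k + 1)) (x k)) {k : ℕ} (hk : k < n)
    {t y : ℝ} (ht : n * t ∈ Icc (k : ℝ) (k + 1)) (hy : y ∈ Icc (-1 : ℝ) 1) :
    strip n x j (t, y) = place (x k) (quad (j k) (j (k + 1)) (n * t - k) ((-1) ^ k * y)) := by
  rcases ht.2.lt_or_eq with h | h
  · have : ⌊n * t⌋₊ = k := (Nat.floor_eq_iff (k.cast_nonneg.trans ht.1)).2 ⟨ht.1, h⟩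
    simp [strip, this]
  · have h1 : ⌊n * t⌋₊ = k + 1 := by
      rw [h]; exact_mod_cast Nat.floor_natCast (k + 1)
    simp only [strip, h1]
    rw [h]
    push_cast
    rw [sub_self, add_sub_cancel_left, quad_zero, quad_one, hx k hk,
      place_gate _ _ (neg_one_pow_mul_mem_Icc _ hy), pow_succ]
    congr 2
    ring

theorem continuousOn_strip (hn : 0 < n) (hx : ∀ k < n, x (k + 1) = M.τ (j (k + 1)) (x k)) :
    ContinuousOn (strip n x j) (Icc 0 1 ×ˢ Icc (-1) 1) := by
  have hn' : (0 : ℝ) < n := by exact_mod_cast hn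
  have hcover : (Icc 0 1 ×ˢ Icc (-1) 1 : Set (ℝ × ℝ)) ⊆
      ⋃ k : Fin n, {p : ℝ × ℝ | n * p.1 ∈ Icc (k : ℝ) (k + 1) ∧ p.2 ∈ Icc (-1 : ℝ) 1} := by
    rintro ⟨t, y⟩ ⟨ht, hy⟩
    rw [mem_iUnion]
    rcases ht.2.lt_or_eq with h | h
    · have h0 : 0 ≤ n * t := mul_nonneg hn'.le ht.1
      refine ⟨⟨⌊n * t⌋₊, ?_⟩, ⟨Nat.floor_le h0, (Nat.lt_floor_add_one _).le⟩, hy⟩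
      rw [Nat.floor_lt h0]
      nlinarith
    -- At `t = 1` the floor is `n`, which is no index; the last piece covers this end.
    · refine ⟨⟨n - 1, by omega⟩, ?_, hy⟩
      simp only at h
      have : ((n - 1 : ℕ) : ℝ) = n - 1 := by push_cast [Nat.cast_sub hn]; simp
      simp [h, this]
  refine ContinuousOn.mono ?_ hcover
  refine (locallyFinite_of_finite _).continuousOn_iUnion (fun k => ?_) fun k => ?_
  · refine IsClosed.inter (isClosed_Icc.preimage (by fun_prop)) (isClosed_Icc.preimage (by fun_prop))
  · refine ContinuousOn.congr (f := fun p : ℝ × ℝ => place (x k)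
      (quad (j k) (j (k + 1)) (n * p.1 - k) ((-1) ^ (k : ℕ) * p.2))) ?_ ?_
    · refine (continuousOn_place (x k)).comp (continuous_quad _ _ _ _ _).continuousOn ?_
      rintro ⟨t, y⟩ ⟨ht, hy⟩
      exact quad_mem_stdSimplex _ _ ⟨by linarith [ht.1], by linarith [ht.2]⟩
        (neg_one_pow_mul_mem_Icc _ hy)
    · rintro ⟨t, y⟩ ⟨ht, hy⟩
      exact strip_eq_of_mem hx k.2 ht hy

theorem strip_injective (hn : 0 < n)
    (hx : ∀ k < n, x (k + 1) = M.τ (j (k + 1)) (x k)) (hxn : x n = x 0)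
    (hjn : j n = j 0) (hinj : InjOn x (Iio n)) (hj : ∀ k < n, j k ≠ j (k + 1))
    {s t y z : ℝ} (hs : s ∈ Ico (0 : ℝ) 1) (ht : t ∈ Ico (0 : ℝ) 1) (hy : y ∈ Icc (-1 : ℝ) 1)
    (hz : z ∈ Icc (-1 : ℝ) 1) (h : strip n x j (s, y) = strip n x j (t, z)) : s = t ∧ y = z := by
  have hn' : (0 : ℝ) < n := by exact_mod_cast hn
  have hs0 : 0 ≤ n * s := mul_nonneg hn'.le hs.1
  have ht0 : 0 ≤ n * t := mul_nonneg hn'.le ht.1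
  have hk : ⌊n * s⌋₊ < n := by
    rw [Nat.floor_lt hs0]; nlinarith [hs.2]
  have hl : ⌊n * t⌋₊ < n := by
    rw [Nat.floor_lt ht0]; nlinarith [ht.2]
  have hu : n * s - ⌊n * s⌋₊ ∈ Ico (0 : ℝ) 1 :=
    ⟨by linarith [Nat.floor_le hs0], by linarith [Nat.lt_floor_add_one (n * s)]⟩
  have hv : n * t - ⌊n * t⌋₊ ∈ Ico (0 : ℝ) 1 :=
    ⟨by linarith [Nat.floor_le ht0], by linarith [Nat.lt_floor_add_one (n * t)]⟩
  simp only [strip] at h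
  set k := ⌊n * s⌋₊
  set l := ⌊n * t⌋₊
  have hy' := neg_one_pow_mul_mem_Icc k hy
  have hz' := neg_one_pow_mul_mem_Icc l hz
  have hp := quad_mem_stdSimplex (j k) (j (k + 1)) ⟨hu.1, hu.2.le⟩ hy'
  have hq := quad_mem_stdSimplex (j l) (j (l + 1)) ⟨hv.1, hv.2.le⟩ hz'
  rw [place, place, dif_pos hp, dif_pos hq] at h
  have hpq := congrArg Subtype.val (mk_eq_mk_iff.1 h).1
  simp only at hpq
  -- The parameter is below `1`, so the point can only lie on the entry side of its triangle.
  have hzero : ∀ i, quad (j k) (j (k + 1)) (n * s - k) ((-1) ^ k * y) i = 0 → i = j k := by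
    intro i hi
    rcases quad_eq_zero (hj k hk) hy' hi with h | h
    · exact h.1
    · exact absurd h.2 hu.2.ne
  rcases eq_or_eq_of_mk_eq_mk h (j k) hzero with h1 | ⟨h0, h1⟩
  · have hlk : l = k := hinj hl hk h1
    rw [hlk] at hpq
    obtain ⟨h2, h3⟩ := quad_injective (hj k hk) hy' hpq
    refine ⟨?_, mul_left_cancel₀ (pow_ne_zero k (by norm_num)) h3⟩
    exact mul_left_cancel₀ hn'.ne' (by linarith)
  -- The second triangle through the point is the cyclic predecessor of `x k`, where the point lies
  -- on the exit side. That requires parameter `1`, which the half-open range excludes.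
  · exfalso
    obtain ⟨m, hm, hjm, hxm⟩ : ∃ m < n, j (m + 1) = j k ∧ x (m + 1) = x k := by
      rcases Nat.eq_zero_or_pos k with h | h
      · exact ⟨n - 1, by omega, by rw [Nat.sub_add_cancel hn, hjn, h],
          by rw [Nat.sub_add_cancel hn, hxn, h]⟩
      · exact ⟨k - 1, by omega, by rw [Nat.sub_add_cancel h], by rw [Nat.sub_add_cancel h]⟩
    have hlm : l = m := by
      refine hinj hl hm ?_
      rw [h1, ← hxm, hx m hm, hjm, M.τ_τ]
    simp only at h0
    rw [hpq] at h0
    rcases quad_eq_zero (hj l hl) hz' h0 with h | h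
    · exact hj l hl (by rw [← h.1, ← hjm, hlm])
    · exact absurd h.2 hv.2.ne

theorem isMobiusBand_strip (hn : Odd n) (hx : ∀ k < n, x (k + 1) = M.τ (j (k + 1)) (x k))
    (hxn : x n = x 0) (hjn : j n = j 0) (hinj : InjOn x (Iio n))
    (hj : ∀ k < n, j k ≠ j (k + 1)) : IsMobiusBand (strip n x j) := by
  refine ⟨continuousOn_strip hn.pos hx, ?_⟩
  -- The parameter `y` is reversed once per triangle, so an odd number of triangles closes up with a
  -- half-twist.
  have hone : ∀ y, strip n x j (1, y) = strip n x j (0, -y) := by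
    intro y
    simp [strip, hxn, hjn, hn.neg_one_pow, quad_zero]
  have hi : ∀ {s t y z : ℝ}, s ∈ Icc (0 : ℝ) 1 → t ∈ Icc (0 : ℝ) 1 → s ≠ 1 → t ≠ 1 →
      y ∈ Icc (-1 : ℝ) 1 → z ∈ Icc (-1 : ℝ) 1 →
      (strip n x j (s, y) = strip n x j (t, z) ↔ s = t ∧ y = z) := by
    intro s t y z hs ht hs1 ht1 hy hz
    refine ⟨strip_injective hn.pos hx hxn hjn hinj hj ⟨hs.1, lt_of_le_of_ne hs.2 hs1⟩
      ⟨ht.1, lt_of_le_of_ne ht.2 ht1⟩ hy hz, ?_⟩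
    rintro ⟨rfl, rfl⟩
    rfl
  have hneg : ∀ {y : ℝ}, y ∈ Icc (-1 : ℝ) 1 → -y ∈ Icc (-1 : ℝ) 1 := by
    intro y hy
    exact ⟨by linarith [hy.2], by linarith [hy.1]⟩
  have h01 : (0 : ℝ) ∈ Icc (0 : ℝ) 1 := by simp
  intro s hs y hy t ht z hz
  by_cases hs1 : s = 1 <;> by_cases ht1 : t = 1
  · subst hs1 ht1
    rw [hone, hone, hi h01 h01 (by simp) (by simp) (hneg hy) (hneg hz)]
    simp
  · subst hs1
    rw [hone, hi h01 ht (by simp) ht1 (hneg hy) hz]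
    simp [ht1, eq_comm]
  · subst ht1
    rw [hone, hi hs h01 hs1 (by simp) hy (hneg hz)]
    simp [hs1, eq_neg_iff_add_eq_zero, add_comm]
  · rw [hi hs ht hs1 ht1 hy hz]
    simp [hs1, ht1]

end strip

/-! ### Orienting the flags. -/

/-- The flags of a surface without Möbius bands can be oriented. -/
theorem exists_orientation (hM : IsOrientableSurface M.Surface) :
    ∃ o : M.Flag → Bool, ∀ i x, o (M.τ i x) = !o x := by
  let Γ : SimpleGraph M.Flag :=
    { Adj := fun x y => ∃ i, y = M.τ i x
      symm := ⟨by rintro x _ ⟨i, rfl⟩; exact ⟨i, (M.τ_τ i x).symm⟩⟩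
      loopless := ⟨by rintro x ⟨i, h⟩; exact M.τ_ne i x h.symm⟩ }
  by_cases hc : Γ.Colorable 2
  · obtain ⟨c⟩ := hc
    refine ⟨fun x => decide (c x = 0), fun i x => ?_⟩
    have := c.valid (show Γ.Adj x (M.τ i x) from ⟨i, rfl⟩)
    have h2 : ∀ a b : Fin 2, a ≠ b → decide (b = 0) = !decide (a = 0) := by decide
    exact h2 _ _ this
  · exfalso
    rw [SimpleGraph.two_colorable_iff_forall_loop_even] at hc
    simp only [not_forall, Nat.not_even_iff_odd] at hc
    obtain ⟨v, w, hw⟩ := hc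
    obtain ⟨n, x, hn, hadj, hxn, hinj⟩ := exists_simple_odd_closed_walk (r := Γ.Adj)
      (x := w.getVert) hw (fun k hk => w.adj_getVert_succ hk) (by simp)
    have hside : ∀ k, ∃ i, k < n → x (k + 1) = M.τ i (x k) := by
      intro k
      by_cases hk : k < n
      · obtain ⟨i, hi⟩ := hadj k hk
        exact ⟨i, fun _ => hi⟩
      · exact ⟨0, fun h => absurd h hk⟩
    choose i hi using hside
    have hn3 : 3 ≤ n := by
      obtain ⟨m, rfl⟩ := hn
      rcases Nat.eq_zero_or_pos m with rfl | h
      · exact absurd ((hi 0 (by simp)).symm.trans hxn) (M.τ_ne _ _)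
      · omega
    -- `j k` is the side through which `x k` is entered; for `k = 0` this is the side crossed by the
    -- last step.
    let j : ℕ → Fin 3 := fun k => if k = 0 then i (n - 1) else i (k - 1)
    refine hM ⟨_, isMobiusBand_strip (x := x) (j := j) hn (fun k hk => ?_) hxn ?_ hinj
      fun k hk h => ?_⟩
    · simpa [j] using hi k hk
    · simp [j]
    -- Leaving through the entry side would backtrack to the previous flag, impossible in a simple
    -- closed walk of length at least `3`.
    · have hstep : x (k + 1) = M.τ (j k) (x k) := by
        rw [h]; simpa [j] using hi k hk
      rcases Nat.eq_zero_or_pos k with rfl | hk0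
      · have h1 := hi (n - 1) (by omega)
        rw [Nat.sub_add_cancel (by omega), hxn] at h1
        have : x 1 = x (n - 1) := by
          rw [hstep, h1]; simp [j, M.τ_τ]
        have := hinj (by simp; omega) (by simp; omega) this
        omega
      · obtain ⟨k, rfl⟩ : ∃ k', k = k' + 1 := ⟨k - 1, by omega⟩
        have h1 := hi k (by omega)
        have h2 : x (k + 1 + 1) = x k := by
          rw [hstep, h1]; simp [j, M.τ_τ]
        rcases Nat.lt_or_ge (k + 1 + 1) n with hlt | hge
        · have := hinj hlt (show k < n by omega) h2
          omega
        · rw [show k + 1 + 1 = n by omega, hxn] at h2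
          have := hinj (show 0 < n by omega) (show k < n by omega) h2
          omega

end FlagSystem

theorem IsMobiusBand.comp_homeomorph {F F' : Type*} [TopologicalSpace F] [TopologicalSpace F']
    {f : ℝ × ℝ → F} (hf : IsMobiusBand f) (h : F ≃ₜ F') : IsMobiusBand (h ∘ f) := by
  refine ⟨h.continuous.comp_continuousOn hf.1, fun s hs y hy t ht z hz => ?_⟩
  rw [← hf.2 s hs y hy t ht z hz]
  exact h.injective.eq_iff

theorem IsOrientableSurface.of_homeomorph {F F' : Type*} [TopologicalSpace F]
    [TopologicalSpace F'] (hF : IsOrientableSurface F) (h : F' ≃ₜ F) : IsOrientableSurface F' :=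
  fun ⟨_, hf⟩ => hF ⟨_, hf.comp_homeomorph h⟩

/-! ### Half-edges and their flags. -/

theorem coe_halfParam (b : Bool) (t : unitInterval) :
    (halfParam b t : ℝ) = if b then 1 - (t : ℝ) / 2 else (t : ℝ) / 2 := by
  cases b <;> simp [halfParam]

theorem halfParam_mem_Ioo (b : Bool) {t : unitInterval} (ht : 0 < t) :
    halfParam b t ∈ Ioo (0 : unitInterval) 1 := by
  have h0 : (0 : ℝ) < t := ht
  have h1 : (t : ℝ) ≤ 1 := t.2.2
  constructor
  · rw [← Subtype.coe_lt_coe, coe_halfParam]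
    cases b <;> simp only [Set.Icc.coe_zero, reduceIte, Bool.false_eq_true] <;> linarith
  · rw [← Subtype.coe_lt_coe, coe_halfParam]
    cases b <;> simp only [Set.Icc.coe_one, reduceIte, Bool.false_eq_true] <;> linarith

/-- The two halves of an edge meet only at its midpoint, which has parameter `1` in both; one bound
`t < 1` suffices. -/
theorem halfParam_inj {b b' : Bool} {t t' : unitInterval} (ht : t < 1)
    (h : halfParam b t = halfParam b' t') : b = b' ∧ t = t' := by
  have h1 : (t : ℝ) < 1 := ht
  have h1' : (t' : ℝ) ≤ 1 := t'.2.2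
  have h := congrArg (Subtype.val) h
  rw [coe_halfParam, coe_halfParam] at h
  cases b <;> cases b' <;> simp at h <;> first | exact ⟨rfl, Subtype.ext h⟩ | (exfalso; linarith)

theorem continuous_halfParam (b : Bool) : Continuous (halfParam b) := by
  rw [continuous_induced_rng]
  have : (Subtype.val ∘ halfParam b) = fun t : unitInterval =>
      if b then 1 - (t : ℝ) / 2 else (t : ℝ) / 2 := funext (coe_halfParam b)
  rw [this]
  cases b <;> simp <;> fun_prop

namespace EmbeddedGraph

variable {F : Type*} [TopologicalSpace F]

/-- The half `h` of an edge, as a path that starts at a vertex. -/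
noncomputable def halfArc (G : EmbeddedGraph F) (h : G.E × Bool) (t : unitInterval) : F :=
  G.arc h.1 (halfParam h.2 t)

theorem halfArc_zero (G : EmbeddedGraph F) (h : G.E × Bool) :
    G.halfArc h 0 = G.point (G.ends h.1 h.2) := by
  obtain ⟨e, b⟩ := h
  cases b
  · rw [← G.arc_zero]
    refine congrArg (G.arc e) (Subtype.ext ?_)
    simp [coe_halfParam]
  · rw [← G.arc_one]
    refine congrArg (G.arc e) (Subtype.ext ?_)
    simp [coe_halfParam]

theorem continuous_halfArc (G : EmbeddedGraph F) (h : G.E × Bool) : Continuous (G.halfArc h) :=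
  (G.arc h.1).continuous.comp (continuous_halfParam _)

theorem halfArc_inj (G : EmbeddedGraph F) {h h' : G.E × Bool} {t t' : unitInterval}
    (ht : 0 < t) (ht1 : t < 1) (ht' : 0 < t') (heq : G.halfArc h t = G.halfArc h' t') :
    h = h' ∧ t = t' := by
  obtain ⟨h1, h2⟩ := G.arc_injective _ _ _ (halfParam_mem_Ioo _ ht) _ (halfParam_mem_Ioo _ ht') heq
  obtain ⟨h3, h4⟩ := halfParam_inj ht1 h2
  exact ⟨Prod.ext h1 h3, h4⟩

theorem halfArc_ne_point (G : EmbeddedGraph F) {h : G.E × Bool} {t : unitInterval}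
    (ht : 0 < t) (v : G.V) : G.halfArc h t ≠ G.point v :=
  G.arc_ne_point _ _ (halfParam_mem_Ioo _ ht) v

namespace RibbonStructure

variable {G : EmbeddedGraph F} (R : G.RibbonStructure)

theorem homeo_mk (x : R.Flag) (t : unitInterval) :
    R.homeo (Quot.mk _ ⟨x, sidePoint t⟩) = G.halfArc (R.half x) t := R.homeo_side x t

/-- The middle parameter of a half-edge. -/
noncomputable def midParam : unitInterval := ⟨1 / 2, by norm_num, by norm_num⟩

theorem midParam_pos : 0 < midParam := by
  rw [← Subtype.coe_lt_coe]; simp [midParam]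

theorem midParam_lt_one : midParam < 1 := by
  rw [← Subtype.coe_lt_coe]; simp only [midParam, Set.Icc.coe_one]; norm_num

theorem half_τ_two (x : R.Flag) : R.half (R.τ 2 x) = R.half x := by
  have h : Quot.mk R.Glue ⟨x, sidePoint midParam⟩ =
      Quot.mk R.Glue ⟨R.τ 2 x, sidePoint midParam⟩ :=
    Quot.sound (.side 2 x _ (by simp [sidePoint]))
  have h := congrArg R.homeo h
  rw [homeo_mk, homeo_mk] at h
  exact (G.halfArc_inj midParam_pos midParam_lt_one midParam_pos h).1.symm

/-- A point in the interior of the vertex-edge side lies on no other side, hence in only two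
triangles. -/
theorem eq_or_eq_of_half_eq {x y : R.Flag} (h : R.half x = R.half y) : y = x ∨ y = R.τ 2 x := by
  have h1 : R.homeo (Quot.mk _ ⟨x, sidePoint midParam⟩) =
      R.homeo (Quot.mk _ ⟨y, sidePoint midParam⟩) := by
    rw [homeo_mk, homeo_mk, h]
  refine (FlagSystem.eq_or_eq_of_mk_eq_mk (R.homeo.injective h1) 2 ?_).imp_right And.right
  intro k hk
  fin_cases k
  · norm_num [sidePoint, midParam] at hk
  · norm_num [sidePoint, midParam] at hk
  · rfl

theorem half_τ_zero_fst (x : R.Flag) : (R.half (R.τ 0 x)).1 = (R.half x).1 := by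
  have h : Quot.mk R.Glue ⟨x, sidePoint 1⟩ = Quot.mk R.Glue ⟨R.τ 0 x, sidePoint 1⟩ :=
    Quot.sound (.side 0 x _ (by simp [sidePoint]))
  have h := congrArg R.homeo h
  rw [homeo_mk, homeo_mk] at h
  exact (G.arc_injective _ _ _ (halfParam_mem_Ioo _ zero_lt_one) _
    (halfParam_mem_Ioo _ zero_lt_one) h).1.symm

theorem half_τ_zero_snd (x : R.Flag) : (R.half (R.τ 0 x)).2 = !(R.half x).2 := by
  by_contra hne
  have h2 : (R.half x).2 = (R.half (R.τ 0 x)).2 := by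
    revert hne
    cases (R.half (R.τ 0 x)).2 <;> cases (R.half x).2 <;> simp
  rcases R.eq_or_eq_of_half_eq (Prod.ext (R.half_τ_zero_fst x).symm h2) with h | h
  · exact R.τ_ne 0 x h
  · exact R.τ_τ_ne x (by rw [← h, R.τ_τ])

/-- The flags of an edge. -/
theorem eq_of_half_fst_eq {x y : R.Flag} (h : (R.half x).1 = (R.half y).1) :
    y = x ∨ y = R.τ 2 x ∨ y = R.τ 0 x ∨ y = R.τ 0 (R.τ 2 x) := by
  by_cases h2 : (R.half x).2 = (R.half y).2
  · rcases R.eq_or_eq_of_half_eq (Prod.ext h h2) with h | h <;> simp [h]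
  · have h3 : R.half (R.τ 0 x) = R.half y := by
      refine Prod.ext ((R.half_τ_zero_fst x).trans h) ?_
      rw [half_τ_zero_snd]
      revert h2
      cases (R.half y).2 <;> cases (R.half x).2 <;> simp
    rcases R.eq_or_eq_of_half_eq h3 with h | h
    · simp [h]
    · simp [h, R.τ_comm]

/-- The vertex of a flag. -/
def vertex (x : R.Flag) : G.V := G.ends (R.half x).1 (R.half x).2

/-- Distinct vertices are distinct points of `F`, so flags with a common vertex are exactly those
glued at corner `0`. -/
theorem vertex_eq_iff {x y : R.Flag} :
    R.vertex x = R.vertex y ↔ Relation.EqvGen (R.Meet (sidePoint 0)) x y := by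
  rw [← G.point_injective.eq_iff, vertex, vertex, ← halfArc_zero, ← halfArc_zero, ← homeo_mk,
    ← homeo_mk, R.homeo.injective.eq_iff, FlagSystem.mk_eq_mk_iff]
  simp

theorem vertex_τ_one (x : R.Flag) : R.vertex (R.τ 1 x) = R.vertex x :=
  (R.vertex_eq_iff.2 (.rel _ _ ⟨1, by simp [sidePoint], rfl⟩)).symm

theorem vertex_τ_two (x : R.Flag) : R.vertex (R.τ 2 x) = R.vertex x := by
  rw [vertex, half_τ_two, vertex]

/-- The flags at a vertex are obtained from each other by `τ 1` and `τ 2`. -/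
theorem mem_of_vertex_eq {S : Set R.Flag} (h1 : ∀ x ∈ S, R.τ 1 x ∈ S) (h2 : ∀ x ∈ S, R.τ 2 x ∈ S)
    {x y : R.Flag} (h : R.vertex x = R.vertex y) (hx : x ∈ S) : y ∈ S := by
  refine (FlagSystem.mem_of_eqvGen_meet ?_ (R.vertex_eq_iff.1 h)).1 hx
  intro i hi
  fin_cases i
  · simp [sidePoint] at hi
  · exact h1
  · exact h2

end RibbonStructure

end EmbeddedGraph

/-! ### The Penrose polynomial as a sum over colourings. -/

namespace EmbeddedGraph

variable {F : Type*} [TopologicalSpace F]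

namespace RibbonStructure

variable {G : EmbeddedGraph F} (R : G.RibbonStructure)

theorem penrose_eval_one (hE : Nonempty G.E) : R.penrose.eval 1 = 0 := by
  classical
  simp only [penrose, Polynomial.eval_finsetSum, Polynomial.eval_mul, Polynomial.eval_pow,
    Polynomial.eval_neg, Polynomial.eval_one, Polynomial.eval_X, one_pow, mul_one]
  simpa using Finset.sum_powerset_neg_one_pow_card_of_nonempty (x := (Finset.univ : Finset G.E))
    Finset.univ_nonempty

/-- A colouring of the medial edge ends that is compatible with the white smoothing at `e`. -/
def WhiteAt (f : R.Flag → Bool) (e : G.E) : Prop :=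
  ∀ x, (R.half x).1 = e → f (R.τ 0 x) = f x

/-- A colouring of the medial edge ends that is compatible with the crossing at `e`. -/
def CrossAt (f : R.Flag → Bool) (e : G.E) : Prop :=
  ∀ x, (R.half x).1 = e → f (R.τ 0 (R.τ 2 x)) = f x

open Classical in
/-- The signed number of ways to smooth a coloured medial graph at `e`. -/
noncomputable def weight (f : R.Flag → Bool) (e : G.E) : ℤ :=
  -(if R.CrossAt f e then 1 else 0) + if R.WhiteAt f e then 1 else 0

theorem forall_stateStep_iff (A : Finset G.E) (f : R.Flag → Bool) :
    (∀ x y, R.StateStep A x y → f x = f y) ↔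
      (∀ x, f (R.τ 1 x) = f x) ∧ (∀ e ∈ A, R.CrossAt f e) ∧ ∀ e ∉ A, R.WhiteAt f e := by
  constructor
  · intro h
    refine ⟨fun x => (h _ _ (.inl rfl)).symm, ?_, ?_⟩
    · rintro e he x rfl
      exact (h _ _ (.inr (.inr ⟨he, rfl⟩))).symm
    · rintro e he x rfl
      exact (h _ _ (.inr (.inl ⟨he, rfl⟩))).symm
  · rintro ⟨h1, h2, h3⟩ x y (rfl | ⟨h, rfl⟩ | ⟨h, rfl⟩)
    · exact (h1 x).symm
    · exact (h3 _ h x rfl).symm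
    · exact (h2 _ h x rfl).symm

open Classical in
-- Colouring the set of curves amounts to colouring flags constantly along curves. The indicator is
-- split over `A` and its complement to match the expansion of a product of sums.
theorem two_pow_stateCurves (A : Finset G.E) :
    (2 : ℤ) ^ R.stateCurves A = ∑ f : R.Flag → Bool with ∀ x, f (R.τ 1 x) = f x,
      (∏ e ∈ A, if R.CrossAt f e then 1 else 0) *
        ∏ e ∈ Finset.univ \ A, if R.WhiteAt f e then 1 else 0 := by
  let φ : (Quot (R.StateStep A) → Bool) ≃
      {f : R.Flag → Bool // ∀ x y, R.StateStep A x y → f x = f y} :=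
    { toFun := fun g => ⟨fun x => g (Quot.mk _ x), fun x y h => congrArg g (Quot.sound h)⟩
      invFun := fun f => Quot.lift f.1 f.2
      left_inv := fun g => by ext ⟨x⟩; rfl
      right_inv := fun f => rfl }
  have h1 : (2 : ℤ) ^ R.stateCurves A =
      Nat.card {f : R.Flag → Bool // ∀ x y, R.StateStep A x y → f x = f y} := by
    rw [← Nat.card_congr φ, Nat.card_fun]
    simp [stateCurves]
  rw [h1, Nat.card_eq_fintype_card, Fintype.card_subtype]
  simp only [forall_stateStep_iff]
  rw [← Finset.filter_filter, Finset.card_filter]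
  push_cast
  refine Finset.sum_congr rfl fun f _ => ?_
  simp only [Finset.prod_ite_zero, Finset.prod_const_one, Finset.mem_sdiff, Finset.mem_univ,
    true_and, mul_ite, mul_one, mul_zero]
  split_ifs <;> tauto

open Classical in
theorem penrose_eval_two : R.penrose.eval 2 =
    ∑ f : R.Flag → Bool with ∀ x, f (R.τ 1 x) = f x, ∏ e, R.weight f e := by
  simp only [penrose, Polynomial.eval_finsetSum, Polynomial.eval_mul, Polynomial.eval_pow,
    Polynomial.eval_neg, Polynomial.eval_one, Polynomial.eval_X, two_pow_stateCurves]
  simp only [Finset.mul_sum]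
  rw [Finset.sum_comm]
  refine Finset.sum_congr rfl fun f _ => ?_
  simp only [weight]
  rw [Finset.prod_add, Finset.powerset_univ]
  refine Finset.sum_congr rfl fun A _ => ?_
  rw [Finset.prod_neg, mul_assoc]

/-- A colouring of the medial edges that alternates around each vertex. -/
def IsAlternating (f : R.Flag → Bool) : Prop :=
  (∀ x, f (R.τ 1 x) = f x) ∧ ∀ x, f (R.τ 2 x) = !f x

/-- White asks that `τ 0` preserve the colours of `x` and `τ 2 x`; the crossing asks the same with
these two colours exchanged. -/
theorem weight_eq_zero {f : R.Flag → Bool} {x : R.Flag} (h : f (R.τ 2 x) = f x) :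
    R.weight f (R.half x).1 = 0 := by
  have key : R.CrossAt f (R.half x).1 ↔ R.WhiteAt f (R.half x).1 := by
    have h1 := R.half_τ_two x
    have h0 := R.half_τ_zero_fst x
    constructor
    · intro hc
      have c1 := hc x rfl
      have c2 := hc (R.τ 2 x) (by rw [h1])
      rw [R.τ_τ] at c2
      intro y hy
      rcases R.eq_of_half_fst_eq hy.symm with rfl | rfl | rfl | rfl <;> simp_all [R.τ_τ]
    · intro hc
      have c1 := hc x rfl
      have c2 := hc (R.τ 2 x) (by rw [h1])
      intro y hy
      rcases R.eq_of_half_fst_eq hy.symm with rfl | rfl | rfl | rfl <;>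
        simp_all [R.τ_τ, ← R.τ_comm]
  by_cases hw : R.WhiteAt f (R.half x).1
  · simp [weight, hw, key.2 hw]
  · simp [weight, hw, mt key.1 hw]

/-- When the two sides of each half-edge differ in colour, exactly one of the two smoothings is
compatible. -/
theorem weight_eq {f : R.Flag → Bool} (hf : ∀ x, f (R.τ 2 x) = !f x) (x : R.Flag) :
    R.weight f (R.half x).1 = if f (R.τ 0 x) = f x then 1 else -1 := by
  have hW : R.WhiteAt f (R.half x).1 ↔ f (R.τ 0 x) = f x := by
    refine ⟨fun h => h x rfl, fun h y hy => ?_⟩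
    rcases R.eq_of_half_fst_eq hy.symm with rfl | rfl | rfl | rfl <;>
        simp_all [R.τ_τ, R.τ_comm]
  have hC : R.CrossAt f (R.half x).1 ↔ ¬ f (R.τ 0 x) = f x := by
    constructor
    · intro h
      have := h x rfl
      rw [R.τ_comm, hf] at this
      revert this
      cases f x <;> cases f (R.τ 0 x) <;> simp
    · intro h y hy
      have hx : f (R.τ 0 x) = !f x := by
        revert h
        cases f x <;> cases f (R.τ 0 x) <;> simp
      rcases R.eq_of_half_fst_eq hy.symm with rfl | rfl | rfl | rfl <;>
        simp_all [R.τ_τ, R.τ_comm]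
  simp only [weight, hW, hC]
  split_ifs <;> simp

end RibbonStructure

end EmbeddedGraph

/-! ### Alternating colourings through the vertex rotation. -/

/-- A permutation whose cycles have even length flips some two-colouring. -/
theorem exists_apply_eq_not_of_even_minimalPeriod {α : Type*} (π : Equiv.Perm α)
    (h : ∀ x, Even (Function.minimalPeriod π x)) : ∃ φ : α → Bool, ∀ x, φ (π x) = !φ x := by
  let rep : α → α := fun x => (Quotient.mk (Equiv.Perm.SameCycle.setoid π) x).out
  have hrep : ∀ x, π.SameCycle (rep x) x := fun x =>
    Quotient.exact (s := Equiv.Perm.SameCycle.setoid π) (Quotient.out_eq _)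
  have hπ : ∀ x, rep (π x) = rep x := fun x =>
    congrArg Quotient.out (Quotient.sound (s := Equiv.Perm.SameCycle.setoid π)
      ((Equiv.Perm.SameCycle.refl π x).apply_left))
  -- `k x` is a displacement of `x` from its cycle's representative; it is determined up to
  -- multiples of the even period, so its parity is well defined and flips under `π`.
  choose k hk using hrep
  refine ⟨fun x => decide (Even (k x)), fun x => ?_⟩
  have h1 : (π ^ (k (π x) - (k x + 1))) • rep x = rep x := by
    have h2 := hk (π x)
    rw [hπ] at h2
    have h3 : (π ^ (k x + 1)) (rep x) = π x := by
      rw [add_comm, zpow_add, Equiv.Perm.mul_apply, hk, zpow_one]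
    rw [Equiv.Perm.smul_def, sub_eq_neg_add, zpow_add, Equiv.Perm.mul_apply, h2, ← h3, zpow_neg,
      ← Equiv.Perm.mul_apply, inv_mul_cancel, Equiv.Perm.one_apply]
  rw [MulAction.zpow_smul_eq_iff_minimalPeriod_dvd] at h1
  have h2 : Even (k (π x) - (k x + 1)) := by
    obtain ⟨c, hc⟩ := (h (rep x)).two_dvd
    refine even_iff_two_dvd.2 (dvd_trans ?_ h1)
    exact ⟨c, by exact_mod_cast hc⟩
  by_cases h3 : Even (k x) <;> by_cases h4 : Even (k (π x)) <;> simp [h3, h4] <;>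
    simp only [Int.even_sub, Int.even_add_one] at h2 <;> tauto

theorem eq_of_sameCycle {α β : Type*} {π : Equiv.Perm α} {f : α → β}
    (hf : ∀ x, f (π x) = f x) {x y : α} (h : π.SameCycle x y) : f x = f y := by
  obtain ⟨k, rfl⟩ := h
  induction k using Int.induction_on generalizing x with
  | zero => simp
  | succ n ih => rw [zpow_add, Equiv.Perm.mul_apply, ← ih, zpow_one, hf]
  | pred n ih =>
    rw [sub_eq_add_neg, zpow_add, Equiv.Perm.mul_apply, ← ih, zpow_neg_one]
    simpa using hf (π⁻¹ x)

namespace EmbeddedGraph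

variable {F : Type*} [TopologicalSpace F]

namespace RibbonStructure

variable {G : EmbeddedGraph F} (R : G.RibbonStructure)

/-- The rotation of the flags around their vertices. -/
def rotation : Equiv.Perm R.Flag where
  toFun x := R.τ 2 (R.τ 1 x)
  invFun x := R.τ 1 (R.τ 2 x)
  left_inv x := by simp [R.τ_τ]
  right_inv x := by simp [R.τ_τ]

theorem orientation_of_sameCycle {o : R.Flag → Bool} (ho : ∀ i x, o (R.τ i x) = !o x)
    {x y : R.Flag} (h : R.rotation.SameCycle x y) : o x = o y :=
  eq_of_sameCycle (fun y => by simp [rotation, ho]) h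

theorem sameCycle_or_of_vertex_eq {x y : R.Flag} (h : R.vertex x = R.vertex y) :
    R.rotation.SameCycle x y ∨ R.rotation.SameCycle x (R.τ 2 y) := by
  refine R.mem_of_vertex_eq (S := {y | R.rotation.SameCycle x y ∨
    R.rotation.SameCycle x (R.τ 2 y)}) ?_ ?_ h (.inl (Equiv.Perm.SameCycle.refl _ _))
  · rintro y (hy | hy)
    · exact .inr hy.apply_right
    · refine .inl ?_
      have : R.rotation (R.τ 1 y) = R.τ 2 y := by simp [rotation, R.τ_τ]
      rw [← this] at hy
      exact Equiv.Perm.sameCycle_apply_right.1 hy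
  · rintro y (hy | hy)
    · exact .inr (by rwa [R.τ_τ])
    · exact .inl hy

theorem vertex_of_sameCycle {x y : R.Flag} (h : R.rotation.SameCycle x y) :
    R.vertex x = R.vertex y :=
  eq_of_sameCycle (fun y => by simp [rotation, vertex_τ_one, vertex_τ_two]) h

/-- The rotation preserves orientation, so its orbit contains exactly one of the two flags of each
half-edge at the vertex. -/
theorem minimalPeriod_rotation {o : R.Flag → Bool} (ho : ∀ i x, o (R.τ i x) = !o x)
    (x : R.Flag) : Function.minimalPeriod R.rotation x = G.degree (R.vertex x) := by
  classical
  have h1 := MulAction.minimalPeriod_eq_card (a := R.rotation) (b := x)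
  rw [← Nat.card_eq_fintype_card] at h1
  have hmem : ∀ y, y ∈ MulAction.orbit (Subgroup.zpowers R.rotation) x ↔
      R.rotation.SameCycle x y := by
    intro y
    constructor
    · rintro ⟨⟨_, k, rfl⟩, hy⟩
      exact ⟨k, hy⟩
    · rintro ⟨k, hy⟩
      exact ⟨⟨_, k, rfl⟩, hy⟩
  refine h1.trans (Nat.card_congr (Equiv.ofBijective
    (fun y => ⟨R.half y.1, (R.vertex_of_sameCycle ((hmem _).1 y.2)).symm⟩) ⟨?_, ?_⟩))
  · rintro ⟨y, hy⟩ ⟨z, hz⟩ hyz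
    rw [hmem] at hy hz
    rcases R.eq_or_eq_of_half_eq (Subtype.ext_iff.1 hyz) with h | h
    · exact Subtype.ext h.symm
    · have h2 := (R.orientation_of_sameCycle ho hy).symm.trans (R.orientation_of_sameCycle ho hz)
      simp only at h
      rw [h, ho] at h2
      simp at h2
  · rintro ⟨h, hh⟩
    obtain ⟨y, rfl⟩ := R.half_surjective h
    rcases R.sameCycle_or_of_vertex_eq (x := x) (y := y) hh.symm with h | h
    · exact ⟨⟨y, (hmem y).2 h⟩, rfl⟩
    · exact ⟨⟨R.τ 2 y, (hmem _).2 h⟩, Subtype.ext (R.half_τ_two y)⟩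

theorem exists_isAlternating {o : R.Flag → Bool} (ho : ∀ i x, o (R.τ i x) = !o x)
    (hdeg : ∀ v, Even (G.degree v)) : ∃ f, R.IsAlternating f := by
  obtain ⟨φ, hφ⟩ := exists_apply_eq_not_of_even_minimalPeriod R.rotation fun x => by
    rw [R.minimalPeriod_rotation ho]; exact hdeg _
  have hφ' : ∀ x, φ (R.τ 2 (R.τ 1 x)) = !φ x := hφ
  -- Only the values of `φ` on positive flags are kept; `τ 1` carries them to the negative ones.
  refine ⟨fun x => if o x then φ x else φ (R.τ 1 x), fun x => ?_, fun x => ?_⟩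
  · cases hx : o x <;> simp [ho, hx, R.τ_τ]
  · cases hx : o x
    · have := hφ' (R.τ 1 x)
      rw [R.τ_τ] at this
      simp [ho, hx, this]
    · have := hφ' (R.τ 1 (R.τ 2 x))
      rw [R.τ_τ, R.τ_τ] at this
      simp [ho, hx, this]

open Classical in
-- The difference of two alternating colourings is invariant under `τ 1` and `τ 2`, hence a function
-- of the vertex: they form a torsor under `G.V → Bool`.
theorem card_isAlternating (hV : Function.Surjective R.vertex) {f₀ : R.Flag → Bool}
    (h₀ : R.IsAlternating f₀) :
    Fintype.card {f // R.IsAlternating f} = 2 ^ Fintype.card G.V := by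
  rw [← Fintype.card_bool, ← Fintype.card_fun]
  symm
  refine Fintype.card_congr (Equiv.ofBijective
    (fun g => ⟨fun x => f₀ x ^^ g (R.vertex x), fun x => ?_, fun x => ?_⟩) ⟨?_, ?_⟩)
  · simp only [h₀.1 x, vertex_τ_one]
  · simp only [h₀.2 x, vertex_τ_two, Bool.not_xor]
  · intro g g' h
    ext v
    obtain ⟨x, rfl⟩ := hV v
    have := congr_fun (Subtype.ext_iff.1 h) x
    simpa using this
  · rintro ⟨f, hf⟩
    choose s hs using hV
    refine ⟨fun v => f₀ (s v) ^^ f (s v), Subtype.ext (funext fun x => ?_)⟩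
    have : (f₀ (s (R.vertex x)) ^^ f (s (R.vertex x))) = (f₀ x ^^ f x) := by
      refine R.mem_of_vertex_eq (S := {y | (f₀ y ^^ f y) = (f₀ x ^^ f x)}) ?_ ?_
        (hs _).symm rfl
      · intro y hy
        simpa [hf.1, h₀.1] using hy
      · intro y hy
        simpa [hf.2, h₀.2] using hy
    simp [this]

theorem prod_weight {o : R.Flag → Bool} (ho : ∀ i x, o (R.τ i x) = !o x) {f : R.Flag → Bool}
    (hf : R.IsAlternating f) : ∏ e, R.weight f e = 1 := by
  classical
  have hfl : ∀ h, ∃ x, R.half x = h ∧ o x = true := by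
    intro h
    obtain ⟨x, rfl⟩ := R.half_surjective h
    cases hx : o x
    · exact ⟨R.τ 2 x, R.half_τ_two x, by simp [ho, hx]⟩
    · exact ⟨x, rfl, hx⟩
  -- `fl h` is the positively oriented flag of the half-edge `h`.
  choose fl hfl ho' using hfl
  have hfl_half : ∀ x, o x = false → fl (R.half x) = R.τ 2 x := by
    intro x hx
    rcases R.eq_or_eq_of_half_eq (hfl (R.half x)).symm with h | h
    · have := ho' (R.half x)
      simp [h, hx] at this
    · exact h
  -- Passing to the next half-edge around the vertex is injective and switches colours, so exactly
  -- half of the `2|E|` half-edges are coloured `true`.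
  have hcard : (Finset.univ.filter fun h => f (fl h) = true).card = Fintype.card G.E := by
    let r : G.E × Bool → G.E × Bool := fun h => R.half (R.τ 1 (fl h))
    have hr : ∀ h, fl (r h) = R.τ 2 (R.τ 1 (fl h)) := fun h =>
      hfl_half _ (by simp [ho, ho'])
    have hfr : ∀ h, f (fl (r h)) = !f (fl h) := fun h => by rw [hr, hf.2, hf.1]
    have hrinj : Function.Injective r := by
      intro h h' heq
      have := (hr h).symm.trans ((congrArg fl heq).trans (hr h'))
      have := congrArg R.half (congrArg (R.τ 1) (congrArg (R.τ 2) this))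
      simpa only [R.τ_τ, hfl] using this
    have h1 : (Finset.univ.filter fun h => f (fl h) = true).card ≤
        (Finset.univ.filter fun h => ¬ f (fl h) = true).card :=
      Finset.card_le_card_of_injOn r (fun h hh => by simpa [-Prod.forall, hfr] using hh) hrinj.injOn
    have h2 : (Finset.univ.filter fun h => ¬ f (fl h) = true).card ≤
        (Finset.univ.filter fun h => f (fl h) = true).card :=
      Finset.card_le_card_of_injOn r (fun h hh => by simpa [-Prod.forall, hfr] using hh) hrinj.injOn
    have h3 := Finset.card_filter_add_card_filter_not (s := (Finset.univ : Finset (G.E × Bool)))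
      (fun h => f (fl h) = true)
    rw [Finset.card_univ, Fintype.card_prod, Fintype.card_bool] at h3
    omega
  let σ : G.E × Bool → ℤ := fun h => if f (fl h) = true then -1 else 1
  have hσ : ∏ h, σ h = (-1) ^ Fintype.card G.E := by
    rw [← hcard, Finset.prod_ite]
    simp
  -- `τ 0` takes the positive flag at one end to the negative flag at the other, so white is
  -- compatible exactly when the two positive flags of `e` differ in colour.
  have hw : ∀ e, R.weight f e = -1 * (σ (e, true) * σ (e, false)) := by
    intro e
    have h1 := R.weight_eq hf.2 (fl (e, false))
    rw [hfl] at h1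
    have h2 : R.half (R.τ 0 (fl (e, false))) = (e, true) :=
      Prod.ext (by rw [half_τ_zero_fst, hfl]) (by rw [half_τ_zero_snd, hfl]; rfl)
    have h3 := hfl_half (R.τ 0 (fl (e, false))) (by simp [ho, ho'])
    rw [h2] at h3
    simp only [σ, h1, h3, hf.2]
    cases f (R.τ 0 (fl (e, false))) <;> cases f (fl (e, false)) <;> simp
  have hprod : ∏ e, (σ (e, true) * σ (e, false)) = ∏ h, σ h := by
    rw [Fintype.prod_prod_type]
    simp
  simp only [hw]
  rw [Finset.prod_mul_distrib, hprod, hσ, Finset.prod_const, Finset.card_univ, ← mul_pow]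
  simp

/-- The Penrose polynomial at `2` of a graph with vertices of even positive degree. -/
theorem penrose_eval_two_eq (hF : IsOrientableSurface F) (hdeg : ∀ v, Even (G.degree v))
    (hpos : ∀ v, 0 < G.degree v) : R.penrose.eval 2 = 2 ^ Fintype.card G.V := by
  classical
  obtain ⟨o, ho⟩ := FlagSystem.exists_orientation (hF.of_homeomorph R.homeo)
  obtain ⟨f₀, h₀⟩ := R.exists_isAlternating ho hdeg
  have hV : Function.Surjective R.vertex := by
    intro v
    obtain ⟨⟨h, hh⟩⟩ := (Nat.card_pos_iff.1 (hpos v)).1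
    obtain ⟨x, rfl⟩ := R.half_surjective h
    exact ⟨x, hh⟩
  rw [penrose_eval_two]
  have h1 : ∑ f : R.Flag → Bool with ∀ x, f (R.τ 1 x) = f x, ∏ e, R.weight f e =
      ∑ f : R.Flag → Bool with R.IsAlternating f, 1 := by
    -- A colouring that fails to alternate has a factor `0` by `weight_eq_zero`.
    rw [← Finset.sum_subset (s₁ := Finset.univ.filter R.IsAlternating)]
    · refine Finset.sum_congr rfl fun f hf => ?_
      rw [R.prod_weight ho (Finset.mem_filter.1 hf).2]
    · intro f hf
      simp only [Finset.mem_filter, Finset.mem_univ, true_and] at hf ⊢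
      exact hf.1
    · intro f hf hf'
      simp only [Finset.mem_filter, Finset.mem_univ, true_and] at hf hf'
      obtain ⟨x, hx⟩ : ∃ x, f (R.τ 2 x) = f x := by
        by_contra! hne
        refine hf' ⟨hf, fun x => ?_⟩
        have := hne x
        revert this
        cases f (R.τ 2 x) <;> cases f x <;> simp
      exact Finset.prod_eq_zero (Finset.mem_univ _) (R.weight_eq_zero hx)
  rw [h1, Finset.sum_const, ← Fintype.card_subtype, R.card_isAlternating hV h₀]
  simp

end RibbonStructure

end EmbeddedGraph

/-! ### Degree four at a transverse crossing. -/

/-- The sign `1` or `-1` given by a Boolean value. -/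
def boolSign (a : Bool) : ℝ := if a then 1 else -1

theorem boolSign_mul_self (a : Bool) : boolSign a * boolSign a = 1 := by
  cases a <;> simp [boolSign]

theorem boolSign_mul_pos_inj {a b : Bool} {r : ℝ} (ha : 0 < boolSign a * r)
    (hb : 0 < boolSign b * r) : a = b := by
  cases a <;> cases b <;> simp [boolSign] at ha hb ⊢ <;> linarith

theorem exists_boolSign_mul_pos {f : unitInterval → ℝ} {δ : unitInterval}
    (hf : ContinuousOn f (Icc 0 δ)) (hne : ∀ t ∈ Ioc 0 δ, f t ≠ 0) :
    ∃ a, ∀ t ∈ Ioc 0 δ, 0 < boolSign a * f t := by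
  have hsub : ∀ t ∈ Ioc 0 δ, Icc t δ ⊆ Ioc 0 δ := fun t ht s hs => ⟨ht.1.trans_le hs.1, hs.2⟩
  by_cases h : 0 < f δ
  · refine ⟨true, fun t ht => ?_⟩
    by_contra hneg
    obtain ⟨s, hs, hs0⟩ := intermediate_value_Icc ht.2
      (hf.mono ((hsub t ht).trans Ioc_subset_Icc_self))
      (show (0 : ℝ) ∈ Icc (f t) (f δ) from ⟨by simpa [boolSign] using hneg, h.le⟩)
    exact hne s (hsub t ht hs) hs0
  · refine ⟨false, fun t ht => ?_⟩
    by_contra hneg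
    obtain ⟨s, hs, hs0⟩ := intermediate_value_Icc' ht.2
      (hf.mono ((hsub t ht).trans Ioc_subset_Icc_self))
      (show (0 : ℝ) ∈ Icc (f δ) (f t) from ⟨not_lt.1 h, by simpa [boolSign] using hneg⟩)
    exact hne s (hsub t ht hs) hs0

theorem exists_halfParam_eq (s : unitInterval) : ∃ b t, halfParam b t = s := by
  rcases le_total (s : ℝ) (1 / 2) with h | h
  · refine ⟨false, ⟨2 * s, by linarith [s.2.1], by linarith⟩, Subtype.ext ?_⟩
    rw [coe_halfParam]; simp
  · refine ⟨true, ⟨2 - 2 * s, by linarith [s.2.2], by linarith⟩, Subtype.ext ?_⟩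
    rw [coe_halfParam]; simp; ring

namespace EmbeddedGraph

variable {F : Type*} [TopologicalSpace F] {G : EmbeddedGraph F}

theorem mem_carrier_iff {q : F} :
    q ∈ G.carrier ↔ (∃ v, G.point v = q) ∨ ∃ h t, G.halfArc h t = q := by
  rw [carrier, mem_union, mem_iUnion]
  refine or_congr Iff.rfl ⟨?_, ?_⟩
  · rintro ⟨e, s, rfl⟩
    obtain ⟨b, t, rfl⟩ := exists_halfParam_eq s
    exact ⟨(e, b), t, rfl⟩
  · rintro ⟨h, t, rfl⟩
    exact ⟨h.1, _, rfl⟩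

/-- In the chart `φ` around the vertex `v`, the graph looks like the two coordinate axes. -/
structure IsCrossChart (G : EmbeddedGraph F) (v : G.V) (φ : OpenPartialHomeomorph F (ℝ × ℝ)) :
    Prop where
  mem_source : G.point v ∈ φ.source
  map_point : φ (G.point v) = 0
  mem_carrier : ∀ q ∈ φ.source, q ∈ G.carrier ↔ (φ q).2 = 0 ∨ (φ q).1 = 0

namespace IsCrossChart

variable {v : G.V} {φ : OpenPartialHomeomorph F (ℝ × ℝ)}

/-- A half-edge at the centre of a cross runs along one of its four arms. -/
theorem exists_arm (hφ : G.IsCrossChart v φ) {h : G.E × Bool} (hh : G.ends h.1 h.2 = v) :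
    ∃ δ ∈ Ioo (0 : unitInterval) 1, ∃ a b : Bool,
      (∀ t ∈ Ioc 0 δ, G.halfArc h t ∈ φ.source ∧
        0 < boolSign a * ((φ (G.halfArc h t)).1 + (φ (G.halfArc h t)).2) ∧
        boolSign b * ((φ (G.halfArc h t)).1 - (φ (G.halfArc h t)).2) =
          boolSign a * ((φ (G.halfArc h t)).1 + (φ (G.halfArc h t)).2)) ∧
      ∃ ρ > 0, ∀ r ∈ Ioc 0 ρ, ∃ t ∈ Ioc 0 δ,
        boolSign a * ((φ (G.halfArc h t)).1 + (φ (G.halfArc h t)).2) = r := by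
  have h0 : G.halfArc h 0 = G.point v := by rw [halfArc_zero, hh]
  obtain ⟨δ, hδ, hsrc⟩ : ∃ δ ∈ Ioo (0 : unitInterval) 1,
      ∀ t ∈ Icc 0 δ, G.halfArc h t ∈ φ.source := by
    have hn : G.halfArc h ⁻¹' φ.source ∈ nhds (0 : unitInterval) :=
      (G.continuous_halfArc h).continuousAt.preimage_mem_nhds
        (φ.open_source.mem_nhds (h0 ▸ hφ.mem_source))
    obtain ⟨ε, hε, hball⟩ := Metric.mem_nhds_iff.1 hn
    have hm : 0 < min (ε / 2) (1 / 2) := by positivity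
    refine ⟨⟨min (ε / 2) (1 / 2), hm.le, (min_le_right _ _).trans (by norm_num)⟩, ⟨hm, ?_⟩, ?_⟩
    · exact (min_le_right _ _).trans_lt (show (1 / 2 : ℝ) < 1 by norm_num)
    · intro t ht
      refine hball ?_
      have h1 : (t : ℝ) ≤ min (ε / 2) (1 / 2) := ht.2
      have h2 : (0 : ℝ) ≤ t := ht.1
      rw [Metric.mem_ball, Subtype.dist_eq, Real.dist_eq]
      simp only [Set.Icc.coe_zero, sub_zero, abs_of_nonneg h2]
      linarith [min_le_left (ε / 2) (1 / 2)]
  have hcont : ContinuousOn (fun t => φ (G.halfArc h t)) (Icc 0 δ) :=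
    φ.continuousOn.comp (G.continuous_halfArc h).continuousOn hsrc
  have hcross : ∀ t ∈ Icc 0 δ, (φ (G.halfArc h t)).2 = 0 ∨ (φ (G.halfArc h t)).1 = 0 :=
    fun t ht => (hφ.mem_carrier _ (hsrc t ht)).1 (mem_carrier_iff.2 (.inr ⟨h, t, rfl⟩))
  have hne : ∀ t ∈ Ioc 0 δ, φ (G.halfArc h t) ≠ 0 := by
    intro t ht heq
    rw [← hφ.map_point] at heq
    exact G.halfArc_ne_point ht.1 v
      (φ.injOn (hsrc t (Ioc_subset_Icc_self ht)) hφ.mem_source heq)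
  -- On the axes minus the origin, the sum and the difference of the coordinates are nonzero with
  -- equal absolute value. Their signs `a` and `b`, constant along the half-edge, name the arm.
  obtain ⟨a, ha⟩ := exists_boolSign_mul_pos
    (f := fun t => (φ (G.halfArc h t)).1 + (φ (G.halfArc h t)).2) (hcont.fst.add hcont.snd) (by
      intro t ht heq
      refine hne t ht (Prod.ext ?_ ?_) <;>
        rcases hcross t (Ioc_subset_Icc_self ht) with h | h <;> simp_all)
  obtain ⟨b, hb⟩ := exists_boolSign_mul_pos
    (f := fun t => (φ (G.halfArc h t)).1 - (φ (G.halfArc h t)).2) (hcont.fst.sub hcont.snd) (by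
      intro t ht heq
      refine hne t ht (Prod.ext ?_ ?_) <;>
        rcases hcross t (Ioc_subset_Icc_self ht) with h | h <;> simp_all)
  refine ⟨δ, hδ, a, b, fun t ht => ⟨hsrc t (Ioc_subset_Icc_self ht), ha t ht, ?_⟩,
    _, ha δ ⟨hδ.1, le_rfl⟩, fun r hr => ?_⟩
  · have h1 := ha t ht
    have h2 := hb t ht
    rcases hcross t (Ioc_subset_Icc_self ht) with h | h <;> revert h1 h2 <;> simp only [h] <;>
      cases a <;> cases b <;> simp [boolSign] <;> intros <;> linarith
  · obtain ⟨t, ht, htr⟩ := intermediate_value_Icc hδ.1.le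
      (f := fun t => boolSign a * ((φ (G.halfArc h t)).1 + (φ (G.halfArc h t)).2))
      (continuousOn_const.mul (hcont.fst.add hcont.snd))
      (show r ∈ Icc _ _ from ⟨by simpa [h0, hφ.map_point] using hr.1.le, hr.2⟩)
    refine ⟨t, ⟨lt_of_le_of_ne ht.1 ?_, ht.2⟩, htr⟩
    rintro rfl
    simp only [h0, hφ.map_point] at htr
    exact hr.1.ne (by simpa using htr)

/-- The half-edges at `v` correspond to the four sign pairs. Two on the same arm would share a point
at a common small radius; every arm is used because the rest of the graph stays away from `v`. -/
theorem degree_eq_four [T2Space F] (hφ : G.IsCrossChart v φ) : G.degree v = 4 := by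
  have key : ∀ h : {h : G.E × Bool // G.ends h.1 h.2 = v}, _ := fun h => hφ.exists_arm h.2
  choose δ hδ a b harm ρ hρ hr using key
  have hbij : Function.Bijective fun h => (a h, b h) := by
    constructor
    · intro h h' heq
      obtain ⟨ha, hb⟩ := Prod.mk.inj heq
      have hmin : 0 < min (ρ h) (ρ h') := lt_min (hρ h) (hρ h')
      obtain ⟨t, ht, htr⟩ := hr h _ ⟨hmin, min_le_left _ _⟩
      obtain ⟨t', ht', htr'⟩ := hr h' _ ⟨hmin, min_le_right _ _⟩
      obtain ⟨h1, -, h2⟩ := harm h t ht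
      obtain ⟨h1', -, h2'⟩ := harm h' t' ht'
      rw [htr] at h2
      rw [htr'] at h2'
      rw [← ha] at htr'
      rw [← hb] at h2'
      have hA : boolSign (a h) ≠ 0 := left_ne_zero_of_mul_eq_one (boolSign_mul_self _)
      have hB : boolSign (b h) ≠ 0 := left_ne_zero_of_mul_eq_one (boolSign_mul_self _)
      have e1 := mul_left_cancel₀ hA (htr.trans htr'.symm)
      have e2 := mul_left_cancel₀ hB (h2.trans h2'.symm)
      have : G.halfArc h.1 t = G.halfArc h'.1 t' :=
        φ.injOn h1 h1' (Prod.ext (by linarith) (by linarith))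
      exact Subtype.ext (G.halfArc_inj ht.1 (ht.2.trans_lt (hδ h).2) ht'.1 this).1
    · rintro ⟨c, d⟩
      -- the part of the graph away from the initial segments of the half-edges at `v`
      let K : Set F := (G.point '' {w | w ≠ v}) ∪
        ⋃ h, G.halfArc h '' {t | ∀ hh : G.ends h.1 h.2 = v, δ ⟨h, hh⟩ ≤ t}
      have hK : IsClosed K := by
        refine (toFinite _).isClosed.union (isClosed_iUnion_of_finite fun h => ?_)
        refine (IsCompact.image ?_ (G.continuous_halfArc h)).isClosed
        refine IsClosed.isCompact ?_
        simp only [ofPred_forall]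
        exact isClosed_iInter fun hh => isClosed_Ici
      have hvK : G.point v ∉ K := by
        rintro (⟨w, hw, hwv⟩ | hmem)
        · exact hw (G.point_injective hwv)
        · obtain ⟨h, t, ht, htv⟩ := mem_iUnion.1 hmem
          rcases (unitInterval.nonneg' : 0 ≤ t).eq_or_lt with rfl | h0
          · rw [halfArc_zero] at htv
            have hh := G.point_injective htv
            exact (ht hh).not_gt (hδ _).1
          · exact G.halfArc_ne_point h0 v htv
      -- The point of the arm `(c, d)` at radius `r`: its coordinates have sum `boolSign c * r` and
      -- difference `boolSign d * r`.
      let P : ℝ → ℝ × ℝ := fun r =>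
        ((boolSign c * r + boolSign d * r) / 2, (boolSign c * r - boolSign d * r) / 2)
      have hP : Continuous P := by fun_prop
      have hP0 : P 0 = 0 := by simp [P]
      have h0t : (0 : ℝ × ℝ) ∈ φ.target := hφ.map_point ▸ φ.map_source hφ.mem_source
      have hsymm0 : φ.symm 0 = G.point v := by
        rw [← hφ.map_point, φ.left_inv hφ.mem_source]
      have hev : ∀ᶠ r in nhds (0 : ℝ), P r ∈ φ.target ∧ φ.symm (P r) ∉ K := by
        have ht : ∀ᶠ q in nhds (0 : ℝ × ℝ), q ∈ φ.target ∧ φ.symm q ∉ K := by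
          refine Filter.Eventually.and (φ.open_target.mem_nhds h0t) ?_
          refine (φ.continuousAt_symm h0t).eventually (p := fun q => q ∉ K) ?_
          rw [hsymm0]
          exact hK.isOpen_compl.mem_nhds hvK
        exact hP.continuousAt.eventually (by rwa [hP0])
      obtain ⟨r, ⟨hrt, hrK⟩, hr0⟩ := ((hev.filter_mono nhdsWithin_le_nhds).and
        (self_mem_nhdsWithin (s := Ioi (0 : ℝ)))).exists
      have hr0 : 0 < r := hr0
      have hPr : φ (φ.symm (P r)) = P r := φ.right_inv hrt
      have hcar : φ.symm (P r) ∈ G.carrier := by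
        rw [hφ.mem_carrier _ (φ.map_target hrt), hPr]
        cases c <;> cases d <;> simp [P, boolSign]
      have hnev : φ.symm (P r) ≠ G.point v := by
        intro heq
        rw [heq, hφ.map_point] at hPr
        have h1 := congrArg Prod.fst hPr
        have h2 := congrArg Prod.snd hPr
        revert h1 h2
        cases c <;> cases d <;> simp [P, boolSign] <;> linarith
      rcases mem_carrier_iff.1 hcar with ⟨w, hw⟩ | ⟨h, t, ht⟩
      · refine absurd (.inl ⟨w, ?_, hw⟩) hrK
        rintro rfl
        exact hnev hw.symm
      -- A graph point outside `K` other than `v` must lie on the initial segment of a half-edge at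
      -- `v`, and its signs identify the arm as `(c, d)`.
      · have hnot : ¬ ∀ hh : G.ends h.1 h.2 = v, δ ⟨h, hh⟩ ≤ t := fun hall =>
          hrK (.inr (mem_iUnion.2 ⟨h, t, hall, ht⟩))
        simp only [not_forall, not_le] at hnot
        obtain ⟨hh, hlt⟩ := hnot
        have ht0 : 0 < t := by
          refine lt_of_le_of_ne unitInterval.nonneg' ?_
          rintro rfl
          exact hnev (by rw [← ht, halfArc_zero, hh])
        obtain ⟨-, h1, h2⟩ := harm ⟨h, hh⟩ t ⟨ht0, hlt.le⟩
        rw [ht, hPr] at h1 h2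
        rw [← h2] at h1
        have h3 := h1
        rw [h2] at h1
        have hc : (P r).1 + (P r).2 = boolSign c * r := by simp only [P]; ring
        have hd : (P r).1 - (P r).2 = boolSign d * r := by simp only [P]; ring
        have hsq : ∀ c, 0 < boolSign c * (boolSign c * r) := fun c => by
          rw [← mul_assoc, boolSign_mul_self, one_mul]; exact hr0
        refine ⟨⟨h, hh⟩, Prod.ext ?_ ?_⟩
        · exact boolSign_mul_pos_inj h1 (hc ▸ hsq c)
        · exact boolSign_mul_pos_inj h3 (hd ▸ hsq d)
  rw [degree, Nat.card_congr (Equiv.ofBijective _ hbij)]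
  simp

end IsCrossChart

theorem degree_eq_four_of_isHeegaardGraph [T2Space F] {D : HeegaardDiagram F}
    (hD : D.IsHeegaardGraph G) (v : G.V) : G.degree v = 4 := by
  have hv : G.point v ∈ (⋃ i, range (D.v i)) ∩ ⋃ j, range (D.w j) := hD.1 ▸ mem_range_self v
  obtain ⟨φ, hp, hφ⟩ := D.transverse _ hv
  refine IsCrossChart.degree_eq_four (φ := φ) ⟨hp, ?_, fun q hq => ?_⟩
  · exact Prod.ext ((hφ _ hp).2.1 hv.2) ((hφ _ hp).1.1 hv.1)
  · rw [hD.2, mem_union, (hφ q hq).1, (hφ q hq).2]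

end EmbeddedGraph

theorem mainTheorem6 {F : Type*} [TopologicalSpace F] [T2Space F] [CompactSpace F]
    [ConnectedSpace F] [ChartedSpace (EuclideanSpace ℝ (Fin 2)) F]
    (hF : IsOrientableSurface F)
    (G : EmbeddedGraph F) (hG : G.IsCellular) (R : G.RibbonStructure) :
    (Nonempty G.E → R.penrose.eval 1 = 0) ∧
    (∀ p : ℕ, Fintype.card G.V = p → (∀ v, G.degree v = 4) → R.penrose.eval 2 = 2 ^ p) ∧
    (∀ D : HeegaardDiagram F, D.IsHeegaardGraph G →
      (Fintype.card G.V : ℝ) = Real.logb 2 ((R.penrose.eval 2 : ℤ) : ℝ)) := by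
  have key : (∀ v, G.degree v = 4) → R.penrose.eval 2 = 2 ^ Fintype.card G.V := fun h =>
    R.penrose_eval_two_eq hF (fun v => by rw [h v]; decide) (fun v => by rw [h v]; decide)
  refine ⟨R.penrose_eval_one, ?_, fun D hD => ?_⟩
  · rintro p rfl h
    exact key h
  · rw [key (EmbeddedGraph.degree_eq_four_of_isHeegaardGraph hD)]
    push_cast
    rw [Real.logb_pow, Real.logb_self_eq_one (by norm_num), mul_one]
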